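/- Let $U$ be a differential field (one derivation $'$) whose field of constants is $\mathbb{C}$, let $t\in U$ satisfy $t'=1$, and let $K=\mathbb{C}(t)\subseteq U$. Let $\alpha_1,\alpha_3,\alpha_4\in\mathbb{C}$ be transcendental and algebraically independent over $\mathbb{Q}$, let $\alpha_0\in 2\mathbb{Z}$, and let $\alpha_2$ be given by $\alpha_0+\alpha_1+2\alpha_2+\alpha_3+\alpha_4=1$. Write $\boldsymbol\alpha=(\alpha_0,\alpha_1,\alpha_2,\alpha_3,\alpha_4)$, and let $S_{VI}(\boldsymbol\alpha)$ be the system $$y'=\tfrac{1}{t(t-1)}\Big(2xy(y-1)(y-t)-\{\alpha_4(y-1)(y-t)+\alpha_3y(y-t)+(\alpha_0-1)y(y-1)\}\Big),$$ $$x'=\tfrac{1}{t(t-1)}\Big(-x^2(3y^2-2(1+t)y+t)+x\{2(\alpha_0+\alpha_3+\alpha_4-1)y-\alpha_4(1+t)-\alpha_3t-\alpha_0+1\}-\alpha_2(\alpha_1+\alpha_2)\Big).$$ Let $ric(\alpha_1,\alpha_2,\alpha_3,\alpha_4)\subseteq U^2$ be the set of points $(y,x)$ with $$y=t,\qquad x'=-x^2+\frac{(\alpha_3+\alpha_4-2)t-\alpha_4+1}{t(t-1)}\,x-\frac{\alpha_2(\alpha_1+\alpha_2)}{t(t-1)}.$$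 The Bäcklund transformations $s_0,\dots,s_4$ of $S_{VI}$ act on parameters and points by - $s_0$: $(\alpha_0,\alpha_2)\mapsto(-\alpha_0,\alpha_2+\alpha_0)$, $\;x\mapsto x-\frac{\alpha_0}{y-t}$; - $s_1$: $(\alpha_1,\alpha_2)\mapsto(-\alpha_1,\alpha_2+\alpha_1)$, $\;(y,x)\mapsto(y,x)$; - $s_2$: $\alpha_2\mapsto-\alpha_2$, $\alpha_i\mapsto\alpha_i+\alpha_2$ for $i\neq2$, $\;y\mapsto y+\frac{\alpha_2}{x}$; - $s_3$: $(\alpha_3,\alpha_2)\mapsto(-\alpha_3,\alpha_2+\alpha_3)$, $\;x\mapsto x-\frac{\alpha_3}{y-1}$; - $s_4$: $(\alpha_4,\alpha_2)\mapsto(-\alpha_4,\alpha_2+\alpha_4)$, $\;x\mapsto x-\frac{\alpha_4}{y}$, leaving the remaining parameters and coordinates unchanged, where a fraction with numerator $0$ is read as $0$. Let $T=s_2(s_1s_3s_4)s_2(s_1s_3s_4)s_2s_0$ (rightmost factor applied first); on parameters $T$ is $(\alpha_0,\alpha_1,\alpha_2,\alpha_3,\alpha_4)\mapsto(\alpha_0+2,\alpha_1,\alpha_2-1,\alpha_3,\alpha_4)$.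 With $\alpha_0=2n$, the order-one Riccati subvariety $\mathcal{R}(\boldsymbol\alpha)$ of $S_{VI}(\boldsymbol\alpha)$ is the image of $ric(\alpha_1,\alpha_2+n,\alpha_3,\alpha_4)\subseteq S_{VI}(0,\alpha_1,\alpha_2+n,\alpha_3,\alpha_4)$ under $T^n$. Then any two distinct points $p=(y_1,x_1)$ and $q=(y_2,x_2)$ of $\mathcal{R}(\boldsymbol\alpha)$ are algebraically independent over $K=\mathbb{C}(t)$, that is, $$\mathrm{tr.deg}_K K(p)=\mathrm{tr.deg}_K K(q)=1\quad\text{and}\quad \mathrm{tr.deg}_K K(p,q)=2.$$ -/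

import Mathlib

open scoped Differential

namespace PainleveVI

/-- The solution set `X_VI(α)` of the Hamiltonian system `S_VI(α)` in the differential field `U`;
a point is a pair `(y, x)`, and `t` is an element with `t′ = 1`. -/
def solutionSet {U : Type*} [Field U] [Algebra ℂ U] [Differential U] (t : U) (α : Fin 5 → ℂ) :
    Set (U × U) :=
  let a : Fin 5 → U := fun i => algebraMap ℂ U (α i)
  {p | p.1′ = 1 / (t * (t - 1)) * (2 * p.2 * p.1 * (p.1 - 1) * (p.1 - t)
          - (a 4 * (p.1 - 1) * (p.1 - t) + a 3 * p.1 * (p.1 - t)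
              + (a 0 - 1) * p.1 * (p.1 - 1))) ∧
       p.2′ = 1 / (t * (t - 1)) * (-p.2 ^ 2 * (3 * p.1 ^ 2 - 2 * (1 + t) * p.1 + t)
          + p.2 * (2 * (a 0 + a 3 + a 4 - 1) * p.1 - a 4 * (1 + t) - a 3 * t - a 0 + 1)
          - a 2 * (a 1 + a 2))}

/-- The Riccati variety `ric(α₁, α₂, α₃, α₄)` inside `S_VI(0, α₁, α₂, α₃, α₄)`. -/
def ric {U : Type*} [Field U] [Algebra ℂ U] [Differential U] (t : U) (α₁ α₂ α₃ α₄ : ℂ) :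
    Set (U × U) :=
  let c : ℂ → U := algebraMap ℂ U
  {p | p.1 = t ∧
       p.2′ = -p.2 ^ 2 + ((c α₃ + c α₄ - 2) * t - c α₄ + 1) / (t * (t - 1)) * p.2
          - c α₂ * (c α₁ + c α₂) / (t * (t - 1))}

/-- The action of the generators `s₀, …, s₄` of the affine Weyl group of type `D₄` on parameters. -/
def reflection : Fin 5 → (Fin 5 → ℂ) → (Fin 5 → ℂ)
  | 0, α => ![-α 0, α 1, α 2 + α 0, α 3, α 4]
  | 1, α => ![α 0, -α 1, α 2 + α 1, α 3, α 4]
  | 2, α => ![α 0 + α 2, α 1 + α 2, -α 2, α 3 + α 2, α 4 + α 2]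
  | 3, α => ![α 0, α 1, α 2 + α 3, -α 3, α 4]
  | 4, α => ![α 0, α 1, α 2 + α 4, α 3, -α 4]

/-- The five Bäcklund transformations `s₀, …, s₄` of `S_VI`, as birational maps in `(y, x)` that
depend on the parameters `α`; the image of a solution of `S_VI(α)` is a solution of
`S_VI(reflection i α)`. If `y = t`, `y = 1` or `y = 0` holds for a solution, then `α₀ = 0`, `α₃ = 0`
or `α₄ = 0`, respectively, and then `s₀`, `s₃` or `s₄` is the identity on points, in accordance
with `0 / 0 = 0`. -/
def backlundPoint {U : Type*} [Field U] [Algebra ℂ U] (t : U) :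
    Fin 5 → (Fin 5 → ℂ) → U × U → U × U
  | 0, α, (y, x) => (y, x - algebraMap ℂ U (α 0) / (y - t))
  | 1, _, (y, x) => (y, x)
  | 2, α, (y, x) => (y + algebraMap ℂ U (α 2) / x, x)
  | 3, α, (y, x) => (y, x - algebraMap ℂ U (α 3) / (y - 1))
  | 4, α, (y, x) => (y, x - algebraMap ℂ U (α 4) / y)

/-- The Bäcklund transformations acting on a parameter tuple together with a point. -/
def backlundMap {U : Type*} [Field U] [Algebra ℂ U] (t : U) (i : Fin 5)
    (s : (Fin 5 → ℂ) × (U × U)) : (Fin 5 → ℂ) × (U × U) :=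
  (reflection i s.1, backlundPoint t i s.1 s.2)

theorem backlundMap_involutive {U : Type*} [Field U] [Algebra ℂ U] (t : U) (i : Fin 5) :
    Function.Involutive (backlundMap t i) := by
  rintro ⟨α, y, x⟩
  fin_cases i <;> refine Prod.ext (funext fun j => ?_) (Prod.ext ?_ ?_) <;>
    first
      | (fin_cases j <;> simp [backlundMap, reflection])
      | simp [backlundMap, backlundPoint, reflection, neg_div]

/-- The Bäcklund transformations as permutations. -/
def backlund {U : Type*} [Field U] [Algebra ℂ U] (t : U) (i : Fin 5) :
    Equiv.Perm ((Fin 5 → ℂ) × (U × U)) :=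
  (backlundMap_involutive t i).toPerm

/-- The Bäcklund transformation (a translation in the affine Weyl group) which acts on parameters by
`(α₀, α₁, α₂, α₃, α₄) ↦ (α₀ + 2, α₁, α₂ - 1, α₃, α₄)`. The factor on the right is applied first. -/
def shift {U : Type*} [Field U] [Algebra ℂ U] (t : U) :
    Equiv.Perm ((Fin 5 → ℂ) × (U × U)) :=
  let s := backlund t
  (s 2 * (s 1 * s 3 * s 4) * s 2 * (s 1 * s 3 * s 4) * s 2) * s 0

/-- The Riccati subvariety `R(α)` of `S_VI(α)` for `α₀ ∈ 2ℤ`: writing `α₀ = 2n`, it is the image of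
`ric(α₁, α₂ + n, α₃, α₄) ⊆ S_VI(0, α₁, α₂ + n, α₃, α₄)` under the `n`-th power of `shift`, the
Bäcklund transformation that carries the parameters `(0, α₁, α₂ + n, α₃, α₄)` to `α`. -/
def riccatiSubvariety {U : Type*} [Field U] [Algebra ℂ U] [Differential U] (t : U)
    (α : Fin 5 → ℂ) : Set (U × U) :=
  {p | ∃ n : ℤ, α 0 = 2 * (n : ℂ) ∧ ∃ p₀ ∈ ric t (α 1) (α 2 + n) (α 3) (α 4),
        (shift t ^ n) (![0, α 1, α 2 + n, α 3, α 4], p₀) = (α, p)}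

/-- Each Bäcklund transformation maps solutions to solutions. -/
theorem backlund_mem {U : Type*} [Field U] [Algebra ℂ U] [Differential U]
    (hconst : ∀ c : ℂ, (algebraMap ℂ U c)′ = 0) (t : U) (ht : t′ = 1)
    (α : Fin 5 → ℂ) (hsum : α 0 + α 1 + 2 * α 2 + α 3 + α 4 = 1) (p : U × U)
    (hp : p ∈ solutionSet t α) (i : Fin 5) (hi : i = 2 → α 1 + α 2 ≠ 0) :
    (backlund t i (α, p)).2 ∈ solutionSet t (backlund t i (α, p)).1 := by
  obtain ⟨y, x⟩ := p
  have h0 : t ≠ 0 := by rintro rfl; simp at ht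
  have h1 : t - 1 ≠ 0 := by
    intro h
    rw [sub_eq_zero.1 h] at ht
    simp at ht
  have hs : algebraMap ℂ U (α 0) = 1 - algebraMap ℂ U (α 1) - 2 * algebraMap ℂ U (α 2) -
      algebraMap ℂ U (α 3) - algebraMap ℂ U (α 4) := by
    have := congrArg (algebraMap ℂ U) hsum
    simp only [map_add, map_mul, map_ofNat, map_one] at this
    linear_combination this
  have H : ∀ c : ℂ, ∀ d : U, (algebraMap ℂ U c / d)′ = -(algebraMap ℂ U c * d′ / d ^ 2) := by
    intro c d
    rw [Derivation.leibniz_div (Differential.deriv (R := U)) (algebraMap ℂ U c) d, hconst]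
    simp [div_eq_inv_mul]
  have hinj : ∀ c : ℂ, algebraMap ℂ U c = 0 → c = 0 := fun c => by simp
  obtain ⟨hy, hx⟩ := hp
  simp only at hy hx
  fin_cases i
  · by_cases ha : α 0 = 0
    · simp [backlund, backlundMap, backlundPoint, reflection, solutionSet, ha] at hy hx ⊢
      exact ⟨hy, hx⟩
    · have hd : y - t ≠ 0 := by
        intro h
        rw [sub_eq_zero.1 h, ht] at hy
        apply ha; apply hinj
        simp at hy
        grind
      simp only [backlund, backlundMap, backlundPoint, reflection, solutionSet, Function.Involutive.coe_toPerm,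
        Fin.zero_eta, Matrix.cons_val, map_sub, H, hy, hx, ht, map_neg, map_add, Set.mem_ofPred_eq]
      generalize algebraMap ℂ U (α 0) = a0 at *
      generalize algebraMap ℂ U (α 1) = a1 at *
      subst hs
      clear hy hx H hinj hconst hsum hi ha
      constructor <;> field_simp <;> ring
  · have e : ((⟨1, by norm_num⟩ : Fin 5)) = 1 := rfl
    simp only [backlund, backlundMap, backlundPoint, reflection, solutionSet, Function.Involutive.coe_toPerm,
      e, Matrix.cons_val, hy, hx, map_neg, map_add, Set.mem_ofPred_eq]
    exact ⟨trivial, by ring⟩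
  · by_cases ha : α 2 = 0
    · simp [backlund, backlundMap, backlundPoint, reflection, solutionSet, ha] at hy hx ⊢
      exact ⟨hy, hx⟩
    · have hd : x ≠ 0 := by
        rintro rfl
        simp only [map_zero] at hx
        field_simp at hx
        have : α 2 * (α 1 + α 2) = 0 := by
          apply hinj
          simp only [map_mul, map_add]
          linear_combination hx
        exact (mul_ne_zero ha (hi rfl)) this
      have e : ((⟨2, by norm_num⟩ : Fin 5)) = 2 := rfl
      simp only [backlund, backlundMap, backlundPoint, reflection, solutionSet, Function.Involutive.coe_toPerm,
        e, Matrix.cons_val, map_add, H, hy, hx, map_neg, Set.mem_ofPred_eq]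
      clear hy hx H hinj hconst hsum hi ha
      generalize algebraMap ℂ U (α 0) = a0 at *
      generalize algebraMap ℂ U (α 1) = a1 at *
      subst hs
      constructor <;> field_simp <;> ring
  · by_cases ha : α 3 = 0
    · simp [backlund, backlundMap, backlundPoint, reflection, solutionSet, ha] at hy hx ⊢
      exact ⟨hy, hx⟩
    · have hd : y - 1 ≠ 0 := by
        intro h
        rw [sub_eq_zero.1 h] at hy
        simp only [Derivation.map_one_eq_zero] at hy
        apply ha; apply hinj
        have h1' : 1 - t ≠ 0 := by rw [← neg_sub]; exact neg_ne_zero.2 h1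
        simp at hy
        grind
      have e : ((⟨3, by norm_num⟩ : Fin 5)) = 3 := rfl
      simp only [backlund, backlundMap, backlundPoint, reflection, solutionSet, Function.Involutive.coe_toPerm,
        e, Matrix.cons_val, map_sub, H, hy, hx, map_neg, map_add,
        Derivation.map_one_eq_zero, Set.mem_ofPred_eq]
      clear hy hx H hinj hconst hsum hi ha
      generalize algebraMap ℂ U (α 0) = a0 at *
      generalize algebraMap ℂ U (α 1) = a1 at *
      subst hs
      constructor <;> field_simp <;> ring
  · by_cases ha : α 4 = 0
    · simp [backlund, backlundMap, backlundPoint, reflection, solutionSet, ha] at hy hx ⊢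
      exact ⟨hy, hx⟩
    · have hd : y ≠ 0 := by
        rintro rfl
        simp only [map_zero] at hy
        apply ha; apply hinj
        simp at hy
        grind
      have e : ((⟨4, by norm_num⟩ : Fin 5)) = 4 := rfl
      simp only [backlund, backlundMap, backlundPoint, reflection, solutionSet, Function.Involutive.coe_toPerm,
        e, Matrix.cons_val, map_sub, H, hy, hx, map_neg, map_add, Set.mem_ofPred_eq]
      clear hy hx H hinj hconst hsum hi ha
      generalize algebraMap ℂ U (α 0) = a0 at *
      generalize algebraMap ℂ U (α 1) = a1 at *
      subst hs
      constructor <;> field_simp <;> ring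

/-- `backlund_mem` in a form that can be iterated. -/
theorem backlund_step {U : Type*} [Field U] [Algebra ℂ U] [Differential U]
    (hconst : ∀ c : ℂ, (algebraMap ℂ U c)′ = 0) (t : U) (ht : t′ = 1) (i : Fin 5)
    (s : (Fin 5 → ℂ) × (U × U)) (α β : Fin 5 → ℂ) (hs : s.1 = α) (hp : s.2 ∈ solutionSet t α)
    (hsum : α 0 + α 1 + 2 * α 2 + α 3 + α 4 = 1) (hi : i = 2 → α 1 + α 2 ≠ 0)
    (hβ : reflection i α = β) :
    (backlund t i s).1 = β ∧ (backlund t i s).2 ∈ solutionSet t β := by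
  obtain ⟨a, p⟩ := s
  subst hs
  subst hβ
  exact ⟨rfl, backlund_mem hconst t ht a hsum p hp i hi⟩

theorem shift_mem {U : Type*} [Field U] [Algebra ℂ U] [Differential U]
    (hconst : ∀ c : ℂ, (algebraMap ℂ U c)′ = 0) (t : U) (ht : t′ = 1)
    (e a c d f : ℂ) (hf : f = 1 - e - a - 2 * c - d)
    (s : (Fin 5 → ℂ) × (U × U)) (hs : s.1 = ![e, a, c, d, f])
    (hp : s.2 ∈ solutionSet t ![e, a, c, d, f]) (h1 : a + c + e ≠ 0) (h2 : 1 - a - c ≠ 0)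
    (h3 : a ≠ 0) :
    (shift t s).1 = ![e + 2, a, c - 1, d, f] ∧
      (shift t s).2 ∈ solutionSet t ![e + 2, a, c - 1, d, f] := by
  subst hf
  simp only [shift, Equiv.Perm.mul_apply]
  obtain ⟨hs, hp⟩ := backlund_step hconst t ht 0 _ _ ![-e, a, c + e, d, 1 - e - a - 2 * c - d] hs hp
    (by simp) (by simp) (by simp [reflection])
  obtain ⟨hs, hp⟩ := backlund_step hconst t ht 2 _ _
    ![c, a + c + e, -c - e, d + c + e, 1 - a - c - d] hs hp
    (by simp; ring) (by simpa [add_assoc] using h1) (by simp [reflection]; grind)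
  obtain ⟨hs, hp⟩ := backlund_step hconst t ht 4 _ _
    ![c, a + c + e, 1 - a - 2 * c - d - e, d + c + e, -(1 - a - c - d)] hs hp
    (by simp; ring) (by simp) (by simp [reflection]; grind)
  obtain ⟨hs, hp⟩ := backlund_step hconst t ht 3 _ _
    ![c, a + c + e, 1 - a - c, -(d + c + e), -(1 - a - c - d)] hs hp
    (by simp; ring) (by simp) (by simp [reflection]; grind)
  obtain ⟨hs, hp⟩ := backlund_step hconst t ht 1 _ _
    ![c, -(a + c + e), 1 + e, -(d + c + e), -(1 - a - c - d)] hs hp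
    (by simp; ring) (by simp) (by simp [reflection]; grind)
  obtain ⟨hs, hp⟩ := backlund_step hconst t ht 2 _ _
    ![c + 1 + e, 1 - a - c, -(1 + e), 1 - d - c, a + c + d + e] hs hp
    (by simp; ring) (by simp; grind) (by simp [reflection]; grind)
  obtain ⟨hs, hp⟩ := backlund_step hconst t ht 4 _ _
    ![c + 1 + e, 1 - a - c, a + c + d - 1, 1 - d - c, -(a + c + d + e)] hs hp
    (by simp; ring) (by simp) (by simp [reflection]; grind)
  obtain ⟨hs, hp⟩ := backlund_step hconst t ht 3 _ _
    ![c + 1 + e, 1 - a - c, a, -(1 - d - c), -(a + c + d + e)] hs hp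
    (by simp; ring) (by simp) (by simp [reflection]; grind)
  obtain ⟨hs, hp⟩ := backlund_step hconst t ht 1 _ _
    ![c + 1 + e, -(1 - a - c), 1 - c, -(1 - d - c), -(a + c + d + e)] hs hp
    (by simp; ring) (by simp) (by simp [reflection]; grind)
  exact backlund_step hconst t ht 2 _ _ _ hs hp
    (by simp; ring) (by simp; grind) (by simp [reflection]; grind)

theorem shift_symm_mem {U : Type*} [Field U] [Algebra ℂ U] [Differential U]
    (hconst : ∀ c : ℂ, (algebraMap ℂ U c)′ = 0) (t : U) (ht : t′ = 1)
    (e a c d f : ℂ) (hf : f = 1 - e - a - 2 * c - d)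
    (s : (Fin 5 → ℂ) × (U × U)) (hs : s.1 = ![e + 2, a, c - 1, d, f])
    (hp : s.2 ∈ solutionSet t ![e + 2, a, c - 1, d, f]) (h1 : a + c + e ≠ 0) (h2 : a + c - 1 ≠ 0)
    (h3 : a ≠ 0) :
    ((shift t)⁻¹ s).1 = ![e, a, c, d, f] ∧
      ((shift t)⁻¹ s).2 ∈ solutionSet t ![e, a, c, d, f] := by
  subst hf
  have hinv : ∀ i, (backlund t i)⁻¹ = backlund t i := fun i => by
    ext1 x; rfl
  simp only [shift, mul_inv_rev, hinv, Equiv.Perm.mul_apply]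
  obtain ⟨hs, hp⟩ := backlund_step hconst t ht 2 _ _
    ![c + 1 + e, -(1 - a - c), 1 - c, -(1 - d - c), -(a + c + d + e)] hs hp
    (by simp; ring) (by simp; grind) (by simp [reflection]; grind)
  obtain ⟨hs, hp⟩ := backlund_step hconst t ht 1 _ _
    ![c + 1 + e, 1 - a - c, a, -(1 - d - c), -(a + c + d + e)] hs hp
    (by simp; ring) (by simp) (by simp [reflection])
  obtain ⟨hs, hp⟩ := backlund_step hconst t ht 3 _ _
    ![c + 1 + e, 1 - a - c, a + c + d - 1, 1 - d - c, -(a + c + d + e)] hs hp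
    (by simp; ring) (by simp) (by simp [reflection]; grind)
  obtain ⟨hs, hp⟩ := backlund_step hconst t ht 4 _ _
    ![c + 1 + e, 1 - a - c, -(1 + e), 1 - d - c, a + c + d + e] hs hp
    (by simp; ring) (by simp) (by simp [reflection]; grind)
  obtain ⟨hs, hp⟩ := backlund_step hconst t ht 2 _ _
    ![c, -(a + c + e), 1 + e, -(d + c + e), -(1 - a - c - d)] hs hp
    (by simp; ring) (by simp; grind) (by simp [reflection]; grind)
  obtain ⟨hs, hp⟩ := backlund_step hconst t ht 1 _ _
    ![c, a + c + e, 1 - a - c, -(d + c + e), -(1 - a - c - d)] hs hp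
    (by simp; ring) (by simp) (by simp [reflection]; grind)
  obtain ⟨hs, hp⟩ := backlund_step hconst t ht 3 _ _
    ![c, a + c + e, 1 - a - 2 * c - d - e, d + c + e, -(1 - a - c - d)] hs hp
    (by simp; ring) (by simp) (by simp [reflection]; grind)
  obtain ⟨hs, hp⟩ := backlund_step hconst t ht 4 _ _
    ![c, a + c + e, -c - e, d + c + e, 1 - a - c - d] hs hp
    (by simp; ring) (by simp) (by simp [reflection]; grind)
  obtain ⟨hs, hp⟩ := backlund_step hconst t ht 2 _ _
    ![-e, a, c + e, d, 1 - e - a - 2 * c - d] hs hp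
    (by simp; ring) (by simp; grind) (by simp [reflection]; grind)
  exact backlund_step hconst t ht 0 _ _ _ hs hp
    (by simp; ring) (by simp) (by simp [reflection])

theorem ric_subset {U : Type*} [Field U] [Algebra ℂ U] [Differential U] (t : U) (ht : t′ = 1)
    (a c d f : ℂ) :
    ric t a c d f ⊆ solutionSet t ![0, a, c, d, f] := by
  rintro ⟨y, x⟩ ⟨rfl, h⟩
  simp only at ht
  have h0 : y ≠ 0 := by rintro rfl; simp at ht
  have h1 : y - 1 ≠ 0 := by
    intro h
    rw [sub_eq_zero.1 h] at ht
    simp at ht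
  simp only [solutionSet, Set.mem_ofPred_eq, Matrix.cons_val, ht, map_zero]
  simp only at h
  refine ⟨by field_simp; ring, ?_⟩
  rw [h]
  field_simp
  ring

theorem shift_zpow_mem {U : Type*} [Field U] [Algebra ℂ U] [Differential U]
    (hconst : ∀ c : ℂ, (algebraMap ℂ U c)′ = 0) (t : U) (ht : t′ = 1)
    (a c d f : ℂ) (hf : f = 1 - a - 2 * c - d) (h3 : a ≠ 0) (hm : ∀ m : ℤ, a - d - f ≠ m)
    (p : U × U) (hp : p ∈ solutionSet t ![0, a, c, d, f]) (n : ℤ) :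
    ((shift t ^ n) (![0, a, c, d, f], p)).1 = ![2 * (n : ℂ), a, c - n, d, f] ∧
    ((shift t ^ n) (![0, a, c, d, f], p)).2 ∈ solutionSet t ![2 * (n : ℂ), a, c - n, d, f] := by
  have key : ∀ m : ℤ, a + c ≠ m := by
    intro m h
    apply hm (2 * m - 1)
    push_cast
    linear_combination 2 * h - hf
  have k1 : ∀ n : ℤ, a + (c - n) + 2 * (n : ℂ) ≠ 0 := by
    intro n h
    apply key (-n)
    push_cast
    linear_combination h
  have k2 : ∀ n : ℤ, 1 - a - (c - n) ≠ 0 := by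
    intro n h
    apply key (n + 1)
    push_cast
    linear_combination -h
  induction n using Int.induction_on with
  | zero => simpa using hp
  | succ n ih =>
    rw [add_comm, zpow_add, zpow_one, Equiv.Perm.mul_apply]
    have := shift_mem hconst t ht (2 * ((n : ℤ) : ℂ)) a (c - (n : ℤ)) d f
      (by rw [hf]; ring) _ ih.1 ih.2 (k1 n) (k2 n) h3
    convert this using 3 <;> push_cast <;> ring_nf
  | pred n ih =>
    rw [sub_eq_neg_add, zpow_add, zpow_neg_one, Equiv.Perm.mul_apply]
    have e1 : 2 * ((-(n : ℤ) : ℤ) : ℂ) = 2 * ((-1 + -(n : ℤ) : ℤ) : ℂ) + 2 := by push_cast; ring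
    have e2 : c - ((-(n : ℤ) : ℤ) : ℂ) = (c - ((-1 + -(n : ℤ) : ℤ) : ℂ)) - 1 := by push_cast; ring
    rw [e1, e2] at ih
    exact shift_symm_mem hconst t ht _ a _ d f
      (by rw [hf]; ring) _ ih.1 ih.2 (k1 _) (fun h => k2 _ (by linear_combination -h)) h3

/-- For the parameters in question, `R(α)` is indeed contained in `S_VI(α)`, and the equality of
parameters in its definition holds automatically. -/
theorem riccatiSubvariety_eq {U : Type*} [Field U] [Algebra ℂ U] [Differential U]
    (hconst : ∀ c : ℂ, (algebraMap ℂ U c)′ = 0) (t : U) (ht : t′ = 1)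
    (α : Fin 5 → ℂ) (hsum : α 0 + α 1 + 2 * α 2 + α 3 + α 4 = 1)
    (hα : AlgebraicIndependent ℚ ![α 1, α 3, α 4]) (n : ℤ) (hn : α 0 = 2 * (n : ℂ)) :
    riccatiSubvariety t α ⊆ solutionSet t α ∧
    riccatiSubvariety t α = (fun p₀ => ((shift t ^ n) (![0, α 1, α 2 + n, α 3, α 4], p₀)).2) ''
      ric t (α 1) (α 2 + n) (α 3) (α 4) := by
  have h3 : α 1 ≠ 0 := by simpa using hα.ne_zero 0
  have hm : ∀ m : ℤ, α 1 - α 3 - α 4 ≠ m := by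
    intro m h
    have := algebraicIndependent_iff.1 hα
      (MvPolynomial.X 0 - MvPolynomial.X 1 - MvPolynomial.X 2 - MvPolynomial.C (m : ℚ))
      (by simp [h])
    have := congrArg (MvPolynomial.eval ![(m : ℚ) + 1, 0, 0]) this
    simp at this
  have hr := ric_subset t ht (α 1) (α 2 + n) (α 3) (α 4)
  have hz : ∀ p₀ ∈ ric t (α 1) (α 2 + n) (α 3) (α 4), _ := fun p₀ h₀ =>
    shift_zpow_mem hconst t ht (α 1) (α 2 + n) (α 3) (α 4) (by linear_combination hsum - hn) h3 hm
      p₀ (hr h₀) n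
  have hα' : ![2 * (n : ℂ), α 1, α 2 + n - n, α 3, α 4] = α := by
    funext j
    fin_cases j <;> simp [hn]
  rw [hα'] at hz
  have hE : riccatiSubvariety t α =
      (fun p₀ => ((shift t ^ n) (![0, α 1, α 2 + n, α 3, α 4], p₀)).2) ''
      ric t (α 1) (α 2 + n) (α 3) (α 4) := by
    ext p
    constructor
    · rintro ⟨m, hm', p₀, h₀, h⟩
      have : m = n := by
        rw [hn] at hm'
        exact_mod_cast (mul_left_cancel₀ two_ne_zero hm').symm
      subst this
      exact ⟨p₀, h₀, by simp only [h]⟩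
    · rintro ⟨p₀, h₀, rfl⟩
      exact ⟨n, hn, p₀, h₀, Prod.ext (hz p₀ h₀).1 rfl⟩
  refine ⟨?_, hE⟩
  rw [hE]
  rintro _ ⟨p₀, h₀, rfl⟩
  exact (hz p₀ h₀).2

end PainleveVI

/-! The Bäcklund transformations are invertible and rational over `ℂ(t)`, so a point of the Riccati
subvariety generates over `ℂ(t)` the same field as the Riccati solution `x` it comes from. Put `τ =
t² - t`, `y = τ x`, `δ = τ d/dt` and `(a, c, d, f) = (α₁, α₂ + n, α₃, α₄)`. The equation becomes `δy
= -y² + ((d + f) t - f) y - c (a + c) τ`, with polynomial coefficients, and two distinct solutions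
have to be shown independent over `K = ℂ(t)`.

The heart is the absence of Darboux polynomials: polynomials `P(t, Y)` of degree `m > 0` in `Y`
dividing their own derivative along the vector field. Degrees force the cofactor to be `g(t) - m Y`.
The lines `t = 0`, `t = 1` and the line at infinity are invariant, and root multiplicities on them
give naturals `nᵢ` with `-f n₀ = g(0)`, `d n₁ = g(1)` and `-a n₂ = g₁ - W + m c`, where `W` is the
total degree of `P` and `g = g₀ + g₁ t`. Eliminating `g` and `c` leaves an integral linear relation
between `1, a, d, f` with constant coefficient `2W - m`. Hence `m = 2W`, while `m ≤ W`, so `m = 0`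
(`natDegree_eq_zero_of_darboux`).

An algebraic solution would have a Darboux minimal polynomial, so every solution is transcendental.
If `y₂` were algebraic over `K(y₁)`, then `1 / (y₂ - y₁)` would be an algebraic solution of a first
order linear equation, and averaging conjugates would give a solution in `K(y₁)`. Its denominator
would be Darboux, so it would be a polynomial in `y₁`, which leading coefficients exclude
(`algebraicIndepOn_of_riccati`). -/

namespace PainleveVI

open Polynomial

/-! ### Darboux polynomials: multiplicities on the invariant lines and at infinity -/

/-- If `(X - ρ) l Q' = s Q`, comparing lowest order terms at `ρ` gives `l(ρ) k = s(ρ)`, where `k` is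
the multiplicity of `ρ` as a root of `Q`. -/
theorem exists_multiplicity_of_mul_derivative_eq {k : Type*} [Field k] {Q l s : k[X]} {ρ : k}
    (hQ : Q ≠ 0) (h : (X - C ρ) * l * derivative Q = s * Q) :
    ∃ n : ℕ, l.eval ρ * n = s.eval ρ := by
  obtain ⟨q, hq, hnd⟩ := exists_eq_pow_rootMultiplicity_mul_and_not_dvd Q hQ ρ
  generalize rootMultiplicity ρ Q = n at hq
  refine ⟨n, ?_⟩
  have hX : (X - C ρ) ^ n ≠ 0 := pow_ne_zero _ (X_sub_C_ne_zero ρ)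
  have key : l * ((n : k[X]) * q + (X - C ρ) * derivative q) = s * q := by
    apply mul_left_cancel₀ hX
    have : (X - C ρ) * derivative Q =
        (X - C ρ) ^ n * ((n : k[X]) * q + (X - C ρ) * derivative q) := by
      rw [hq, derivative_mul, derivative_X_sub_C_pow]
      cases n with
      | zero => simp
      | succ n => simp [pow_succ]; ring
    linear_combination h + s * hq - l * this
  have := congrArg (eval ρ) key
  simp only [eval_mul, eval_add, eval_sub, eval_X, eval_C, sub_self, zero_mul, add_zero,
    eval_natCast] at this
  have hq0 : q.eval ρ ≠ 0 := fun h0 => hnd (dvd_iff_isRoot.2 h0)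
  apply mul_right_cancel₀ hq0
  linear_combination this

/-- This and the next two lemmas compute the top coefficients of the terms of the vector field: each
term raises the total degree in `t` and `Y` by at most one. -/
theorem coeff_sq_sub_mul_derivative {k : Type*} [CommRing k] {p : k[X]} {n : ℕ}
    (hp : ∀ i, n < i → p.coeff i = 0) :
    ((X ^ 2 - X) * derivative p).coeff (n + 1) = n * p.coeff n := by
  have e : (X ^ 2 - X) * derivative p = X * (X * derivative p) - X * derivative p := by ring
  rw [e, coeff_sub, coeff_X_mul, coeff_X_mul, coeff_derivative, hp (n + 1) (by lia)]
  cases n with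
  | zero => simp
  | succ n => rw [coeff_X_mul, coeff_derivative]; push_cast; ring

theorem coeff_sq_sub_mul {k : Type*} [CommRing k] {p : k[X]} {n : ℕ}
    (hp : ∀ i, n ≤ i → p.coeff i = 0) :
    ((X ^ 2 - X) * p).coeff (n + 1) = p.coeff (n - 1) := by
  have e : (X ^ 2 - X) * p = X * (X * p) - X * p := by ring
  rw [e, coeff_sub, coeff_X_mul, coeff_X_mul, hp n le_rfl]
  -- For `n = 0` the index `n - 1` truncates to `0`; both sides then vanish because `p` does.
  cases n with
  | zero => simp [hp 0 le_rfl]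
  | succ n => simp

theorem coeff_linear_mul {k : Type*} [CommRing k] {p : k[X]} {n : ℕ} (a b : k)
    (hp : ∀ i, n < i → p.coeff i = 0) :
    ((C a * X + C b) * p).coeff (n + 1) = a * p.coeff n := by
  rw [add_mul, coeff_add, mul_assoc, coeff_C_mul, coeff_X_mul, coeff_C_mul, hp (n + 1) (by lia)]
  simp

/-- The weighted degree of a nonzero bivariate polynomial. -/
theorem exists_weightedDegree {k : Type*} [CommRing k] {P : k[X][X]} (hP : P ≠ 0) :
    ∃ W : ℕ, P.natDegree ≤ W ∧ (∀ k i, W < k + i → (P.coeff k).coeff i = 0) ∧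
      ∃ k ≤ W, (P.coeff k).coeff (W - k) ≠ 0 := by
  classical
  let w : ℕ → ℕ := fun k => k + (P.coeff k).natDegree
  obtain ⟨k₀, hk₀, hmax⟩ := P.support.exists_max_image w (support_nonempty.2 hP)
  refine ⟨w k₀, ?_, ?_, k₀, Nat.le_add_right _ _, ?_⟩
  · exact (Nat.le_add_right _ _).trans (hmax _ (natDegree_mem_support_of_nonzero hP))
  · intro k i hki
    by_cases hk : k ∈ P.support
    · have := hmax k hk
      apply coeff_eq_zero_of_natDegree_lt
      simp only [w] at this hki
      lia
    · simp [notMem_support_iff.1 hk]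
  · have : w k₀ - k₀ = (P.coeff k₀).natDegree := by simp [w]
    rw [this]
    simpa using hk₀

/-- The behaviour at infinity of a Darboux polynomial of the vector field
`(t² - t) ∂ₜ + (-Y² + (M₁ t + M₀) Y + N (t² - t)) ∂_Y`. The polynomial `R` is the part of top weighted
degree, dehomogenised. -/
theorem exists_leadingForm {k : Type*} [Field k] {P P' : k[X][X]} (hP : P ≠ 0)
    (hP' : ∀ j, P'.coeff j = (X ^ 2 - X) * derivative (P.coeff j)) {M₁ M₀ N m : k} {g : k[X]}
    (h : P' + (-X ^ 2 + C (C M₁ * X + C M₀) * X + C (C N * (X ^ 2 - X))) * derivative P =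
      (C g - C (C m) * X) * P) :
    ∃ W : ℕ, P.natDegree ≤ W ∧ g.natDegree ≤ 1 ∧ ∃ R : k[X], R ≠ 0 ∧
      (-X ^ 2 + C (M₁ - 1) * X + C N) * derivative R = (C (g.coeff 1 - W) - C m * X) * R := by
  obtain ⟨W, hmW, hW, k₀, hk₀, hne⟩ := exists_weightedDegree hP
  have hPW : ∀ j, W < j → P.coeff j = 0 := fun j hj => coeff_eq_zero_of_natDegree_lt (by lia)
  have h0 : (X ^ 2 - X) * derivative (P.coeff 0) + (X ^ 2 - X) * (C N * P.coeff 1) =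
      g * P.coeff 0 := by
    have := congrArg (coeff · 0) h
    simp only [coeff_add, hP', mul_coeff_zero, coeff_derivative, coeff_sub] at this
    simp [-map_pow] at this
    linear_combination this
  have hs : ∀ j, (X ^ 2 - X) * derivative (P.coeff (j + 1)) - C (j : k) * P.coeff j +
      C (j + 1 : k) * ((C M₁ * X + C M₀) * P.coeff (j + 1)) +
      C (N * (j + 2)) * ((X ^ 2 - X) * P.coeff (j + 2)) =
      g * P.coeff (j + 1) - C m * P.coeff j := by
    intro j
    have := congrArg (coeff · (j + 1)) h
    have e : (-X ^ 2 + C (C M₁ * X + C M₀) * X + C (C N * (X ^ 2 - X))) * derivative P =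
       -(X * (X * derivative P)) + C (C M₁ * X + C M₀) * (X * derivative P) +
        C (C N * (X ^ 2 - X)) * derivative P := by ring
    have e' : (C g - C (C m) * X) * P = C g * P - C (C m) * (X * P) := by ring
    have e3 : (X * derivative P).coeff j = j * P.coeff j := by
      cases j with
      | zero => simp
      | succ j => rw [coeff_X_mul, coeff_derivative]; push_cast; ring
    rw [e, e'] at this
    simp only [coeff_add, hP', coeff_neg, coeff_C_mul, coeff_X_mul, e3, coeff_sub,
      coeff_derivative] at this
    push_cast at this
    simp only [map_mul, map_add, map_natCast, map_one, map_ofNat]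
    linear_combination this
  -- The left side has total degree at most `W + 1`. If `g` had degree at least two, its leading
  -- coefficient times the nonzero top coefficient at `k₀` would survive beyond that degree.
  have hg : g.natDegree ≤ 1 := by
    by_contra! hg
    have hb : (P.coeff k₀).natDegree ≤ W - k₀ :=
      natDegree_le_iff_coeff_eq_zero.2 fun i hi => hW _ _ (by lia)
    have hgp := coeff_mul_add_eq_of_natDegree_le (le_refl g.natDegree) hb
    have hgc : g.coeff g.natDegree ≠ 0 := by
      rw [coeff_natDegree, leadingCoeff_ne_zero]
      rintro rfl
      simp at hg
    obtain ⟨e, he⟩ : ∃ e, g.natDegree = e + 2 := ⟨g.natDegree - 2, by lia⟩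
    have ei : g.natDegree + (W - k₀) = (e + (W - k₀) + 1) + 1 := by lia
    have t1 : ((X ^ 2 - X) * derivative (P.coeff k₀)).coeff ((e + (W - k₀) + 1) + 1) = 0 := by
      rw [coeff_sq_sub_mul_derivative fun i hi => hW _ _ (by lia), hW _ _ (by lia), mul_zero]
    have t3 : ((X ^ 2 - X) * P.coeff (k₀ + 1)).coeff ((e + (W - k₀) + 1) + 1) = 0 := by
      rw [coeff_sq_sub_mul fun i hi => hW _ _ (by lia), hW _ _ (by lia)]
    apply mul_ne_zero hgc hne
    rw [← hgp, ei]
    cases k₀ with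
    | zero =>
      rw [← h0, coeff_add, t1, mul_left_comm, coeff_C_mul, t3]
      simp
    | succ j =>
      have := congrArg (coeff · ((e + (W - (j + 1)) + 1) + 1)) (hs j)
      simp only [coeff_add, coeff_sub, coeff_C_mul, t1, t3] at this
      rw [coeff_linear_mul _ _ fun i hi => hW _ _ (by lia), hW j _ (by lia),
        hW (j + 1) _ (by lia)] at this
      simpa using this.symm
  -- `R` is the top homogeneous form of `P` at `t = 1`. By Euler's relation the term `t² ∂ₜ`
  -- contributes `W R - X R'`, whence `M₁ - 1` and `g₁ - W`.
  refine ⟨W, hmW, hg, ∑ j ∈ Finset.range (W + 1), monomial j ((P.coeff j).coeff (W - j)), ?_, ?_⟩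
  all_goals
    -- This also holds for `j > W`, where `W - j` truncates to `0`, because then `P.coeff j = 0`.
    have hR : ∀ j, (∑ j ∈ Finset.range (W + 1), monomial j ((P.coeff j).coeff (W - j))).coeff j =
        (P.coeff j).coeff (W - j) := by
      intro j
      rw [finsetSum_coeff]
      simp only [coeff_monomial, Finset.sum_ite_eq', Finset.mem_range]
      split_ifs with hj
      · rfl
      · rw [hPW j (by lia), coeff_zero]
    generalize (∑ j ∈ Finset.range (W + 1), monomial j ((P.coeff j).coeff (W - j))) = R at hR
  · rintro rfl
    exact hne (by rw [← hR, coeff_zero])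
  have hg' : g = C (g.coeff 1) * X + C (g.coeff 0) := eq_X_add_C_of_natDegree_le_one hg
  generalize g.coeff 1 = g₁ at *
  generalize g.coeff 0 = g₀ at *
  subst hg'
  have e : (-X ^ 2 + C (M₁ - 1) * X + C N) * derivative R =
      -(X * (X * derivative R)) + C (M₁ - 1) * (X * derivative R) + C N * derivative R := by ring
  have e' : (C (g₁ - (W : k)) - C m * X) * R = C (g₁ - (W : k)) * R - C m * (X * R) := by ring
  rw [e, e']
  ext j
  cases j with
  | zero =>
    have t1 := coeff_sq_sub_mul_derivative (n := W) (p := P.coeff 0) fun i hi => hW _ _ (by lia)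
    have t2 := coeff_linear_mul (n := W) (p := P.coeff 0) g₁ g₀ fun i hi => hW _ _ (by lia)
    have t3 := coeff_sq_sub_mul (n := W) (p := P.coeff 1) fun i hi => hW _ _ (by lia)
    have := congrArg (coeff · (W + 1)) h0
    simp only [coeff_add, t1, t2, mul_left_comm _ (C N), coeff_C_mul, t3] at this
    simp only [coeff_add, coeff_sub, coeff_neg, coeff_derivative, hR, mul_coeff_zero,
      coeff_X_zero, coeff_C_zero]
    simp only [zero_mul, mul_zero, neg_zero, zero_add, sub_zero, Nat.sub_zero, Nat.cast_zero]
    linear_combination this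
  | succ j =>
    have e3 : (X * derivative R).coeff j = j * R.coeff j := by
      cases j with
      | zero => simp
      | succ j => rw [coeff_X_mul, coeff_derivative]; push_cast; ring
    simp only [coeff_add, coeff_sub, coeff_neg, coeff_C_mul, coeff_X_mul, e3, coeff_derivative, hR]
    have := hs j
    rcases lt_trichotomy j W with hj | rfl | hj
    · have hv : ∀ i, W - (j + 1) < i → (P.coeff (j + 1)).coeff i = 0 :=
        fun i hi => hW _ _ (by lia)
      have t1 := coeff_sq_sub_mul_derivative hv
      have t2 := coeff_linear_mul g₁ g₀ hv
      have t4 := coeff_linear_mul M₁ M₀ hv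
      have t3 := coeff_sq_sub_mul (n := W - (j + 1)) (p := P.coeff (j + 2))
        fun i hi => hW _ _ (by lia)
      have := congrArg (coeff · (W - (j + 1) + 1)) this
      simp only [coeff_add, coeff_sub, t1, t2, coeff_C_mul, t3, t4] at this
      rw [show W - (j + 1) + 1 = W - j by lia, show W - (j + 1) - 1 = W - (j + 1 + 1) by lia,
        Nat.cast_sub (by lia : j + 1 ≤ W)] at this
      push_cast at this ⊢
      linear_combination this
    · have := congrArg (coeff · 0) this
      simp only [coeff_add, coeff_sub, coeff_C_mul, hPW (j + 1) (by lia),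
        hPW (j + 2) (by lia)] at this
      simp only [hPW (j + 1) (by lia), hPW (j + 1 + 1) (by lia), Nat.sub_self]
      simp only [derivative_zero, mul_zero, coeff_zero] at this ⊢
      linear_combination this
    · simp [hPW j (by lia), hPW (j + 1) (by lia), hPW (j + 1 + 1) (by lia)]

/-- The behaviour of a Darboux polynomial on an invariant line `t = t₀`. -/
theorem exists_nat_of_darboux_eval {k : Type*} [Field k] {P P' : k[X][X]} {τ g M N : k[X]} {t₀ m : k}
    (hP : P.map (evalRingHom t₀) ≠ 0) (hP' : ∀ j, P'.coeff j = τ * derivative (P.coeff j))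
    (hτ : τ.eval t₀ = 0) (hN : N.eval t₀ = 0)
    (h : P' + (-X ^ 2 + C M * X + C N) * derivative P = (C g - C (C m) * X) * P) :
    ∃ n : ℕ, M.eval t₀ * n = g.eval t₀ := by
  have h0 : P'.map (evalRingHom t₀) = 0 := by
    ext j
    simp [hP', hτ]
  have := congrArg (map (evalRingHom t₀)) h
  simp only [Polynomial.map_add, Polynomial.map_mul, Polynomial.map_sub, h0, ← derivative_map,
    Polynomial.map_neg, Polynomial.map_pow, map_X, map_C, coe_evalRingHom, hN, eval_C] at this
  -- On the line only `Y (M(t₀) - Y) ∂_Y` is left of the vector field; its zero `Y = 0` is used.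
  obtain ⟨n, hn⟩ := exists_multiplicity_of_mul_derivative_eq (ρ := 0)
    (l := C (M.eval t₀) - X) (s := C (g.eval t₀) - C m * X) hP (by
      rw [← this]; simp only [map_zero]; ring)
  exact ⟨n, by simpa using hn⟩

/-- The Riccati vector field `(t² - t) ∂ₜ + (-Y² + ((d + f) t - f) Y - c (a + c) (t² - t)) ∂_Y` has no
Darboux polynomial if `1, a, d, f` are linearly independent over `ℚ`. -/
theorem natDegree_eq_zero_of_darboux {k : Type*} [Field k] [CharZero k] {a c d f : k}
    (hsum : a + 2 * c + d + f = 1)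
    (hind : ∀ n₀ n₁ n₂ n₃ : ℤ, (n₀ + n₁ * a + n₂ * d + n₃ * f : k) = 0 → n₀ = 0)
    {P P' : k[X][X]} (hP0 : P.map (evalRingHom 0) ≠ 0) (hP1 : P.map (evalRingHom 1) ≠ 0)
    (hP' : ∀ j, P'.coeff j = (X ^ 2 - X) * derivative (P.coeff j)) {g : k[X]}
    (h : P' + (-X ^ 2 + C (C (d + f) * X + C (-f)) * X +
        C (C (-(c * (a + c))) * (X ^ 2 - X))) * derivative P =
      (C g - C (C (P.natDegree : k)) * X) * P) :
    P.natDegree = 0 := by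
  have hP : P ≠ 0 := by rintro rfl; simp at hP0
  obtain ⟨n₀, h0⟩ := exists_nat_of_darboux_eval hP0 hP' (by simp) (by simp) h
  obtain ⟨n₁, h1⟩ := exists_nat_of_darboux_eval hP1 hP' (by simp) (by simp) h
  obtain ⟨W, hW, hg, R, hR, hinf⟩ := exists_leadingForm hP hP' h
  -- Since `d + f - 1 = -(a + 2 c)`, the quadratic at infinity factors as `-(X + c)(X + a + c)`.
  obtain ⟨n₂, h2⟩ := exists_multiplicity_of_mul_derivative_eq (ρ := -c)
    (l := -(X + C (a + c))) hR (by
      rw [← hinf]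
      have : d + f - 1 = -(a + 2 * c) := by linear_combination hsum
      rw [this]
      simp only [map_neg, map_add, map_mul, map_ofNat]
      ring)
  rw [eq_X_add_C_of_natDegree_le_one hg] at h0 h1
  simp at h0 h1 h2
  -- Substitute `g₁ = g(1) - g(0)` into the relation at infinity and double it, so that `2 c = 1 - a
  -- - d - f` eliminates `c`.
  have := hind (2 * W - P.natDegree) (P.natDegree - 2 * n₂) (P.natDegree - 2 * n₁)
    (P.natDegree - 2 * n₀) (by
      push_cast
      linear_combination 2 * h2 - 2 * h1 + 2 * h0 + P.natDegree * hsum)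
  lia

/-! ### Descent from rational to polynomial coefficients -/

/-- Clear denominators, then divide by the content. Primitivity gives access to Gauss's lemma and
prevents vanishing on a line `t = r`. -/
theorem exists_isPrimitive_associate {R K : Type*} [CommRing R] [IsDomain R] [NormalizedGCDMonoid R]
    [Field K] [Algebra R K] [IsFractionRing R K] {G : K[X]} (hG : G ≠ 0) :
    ∃ (P : R[X]) (u : K), P.IsPrimitive ∧ u ≠ 0 ∧ G = C u * P.map (algebraMap R K) := by
  obtain ⟨b, hb, hbG⟩ := IsLocalization.integerNormalization_spec (nonZeroDivisors R) G
  set H := IsLocalization.integerNormalization (nonZeroDivisors R) G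
  have hinj := IsFractionRing.injective R K
  have hb0 : algebraMap R K b ≠ 0 := by
    rw [Ne, map_eq_zero_iff _ hinj]
    exact nonZeroDivisors.ne_zero hb
  have hbG' : H.map (algebraMap R K) = C (algebraMap R K b) * G := by
    rw [hbG, ← smul_eq_C_mul, algebraMap_smul]
  have hH : H ≠ 0 := by
    intro h
    rw [h, Polynomial.map_zero] at hbG'
    exact mul_ne_zero (C_ne_zero.2 hb0) hG hbG'.symm
  have hc : algebraMap R K H.content ≠ 0 := by
    rwa [Ne, map_eq_zero_iff _ hinj, content_eq_zero_iff]
  refine ⟨H.primPart, algebraMap R K H.content / algebraMap R K b, H.isPrimitive_primPart,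
    div_ne_zero hc hb0, ?_⟩
  apply mul_left_cancel₀ (C_ne_zero.2 hb0)
  rw [← hbG', ← mul_assoc, ← C_mul, mul_div_cancel₀ _ hb0]
  conv_lhs => rw [H.eq_C_content_mul_primPart]
  simp

/-- Otherwise `X - r` would divide every coefficient, hence the content. -/
theorem map_eval_ne_zero_of_isPrimitive {k : Type*} [Field k] {P : k[X][X]} (hP : P.IsPrimitive)
    (r : k) : P.map (evalRingHom r) ≠ 0 := by
  intro h
  refine not_isUnit_X_sub_C r (hP _ ?_)
  rw [C_dvd_iff_dvd_coeff]
  intro j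
  rw [dvd_iff_isRoot]
  simpa using congrArg (coeff · j) h

/-- The cofactor of a Darboux polynomial of a Riccati vector field. -/
theorem exists_cofactor {R : Type*} [CommRing R] [IsDomain R] {P P' : R[X]} {M N : R}
    (hP : P ≠ 0) (hP' : P'.natDegree ≤ P.natDegree)
    (h : P ∣ P' + (-X ^ 2 + C M * X + C N) * derivative P) :
    ∃ g : R, P' + (-X ^ 2 + C M * X + C N) * derivative P = (C g - C (P.natDegree : R) * X) * P := by
  obtain ⟨s, hs⟩ := h
  have hv : (-X ^ 2 + C M * X + C N : R[X]).natDegree ≤ 2 := by compute_degree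
  -- Degree zero is separate because `P.natDegree - 1` truncates.
  rcases Nat.eq_zero_or_pos P.natDegree with h0 | hpos
  · obtain ⟨p, rfl⟩ : ∃ p, P = C p := ⟨_, eq_C_of_natDegree_eq_zero h0⟩
    rw [natDegree_C] at hP'
    have hs0 : s.natDegree = 0 := by
      by_cases hs0 : s = 0
      · simp [hs0]
      have := congrArg natDegree hs
      rw [natDegree_mul hP hs0] at this
      simp at this
      lia
    refine ⟨s.coeff 0, ?_⟩
    rw [hs, eq_C_of_natDegree_eq_zero hs0]
    simp [mul_comm]
  have hd : (derivative P).natDegree ≤ P.natDegree - 1 := natDegree_derivative_le P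
  have hE : (P' + (-X ^ 2 + C M * X + C N) * derivative P).natDegree ≤ P.natDegree + 1 := by
    refine natDegree_add_le_of_degree_le (by lia) (natDegree_mul_le.trans (by lia))
  have hs1 : s.natDegree ≤ 1 := by
    by_cases hs0 : s = 0
    · simp [hs0]
    rw [hs, natDegree_mul hP hs0] at hE
    lia
  -- In this degree only `-Y² ∂_Y` contributes, which fixes the slope of the cofactor as
  -- `-P.natDegree`.
  have hc := congrArg (coeff · (P.natDegree + 1)) hs
  simp only [coeff_add] at hc
  rw [coeff_eq_zero_of_natDegree_lt (by lia : P'.natDegree < _),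
    coeff_mul_add_eq_of_natDegree_le le_rfl hs1, show P.natDegree + 1 = 2 + (P.natDegree - 1) by lia,
    coeff_mul_add_eq_of_natDegree_le hv hd, coeff_derivative, Nat.sub_add_cancel hpos] at hc
  have hl : P.coeff P.natDegree ≠ 0 := by simpa using hP
  have h1 : s.coeff 1 = -(P.natDegree : R) := by
    apply mul_left_cancel₀ hl
    rw [← hc, Nat.cast_sub hpos]
    simp
  refine ⟨s.coeff 0, ?_⟩
  rw [hs]
  conv_lhs => rw [eq_X_add_C_of_natDegree_le_one hs1, h1]
  rw [C_neg]
  ring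

/-- The Riccati equation `τ y′ = -y² + ((d + f) t - f) y - c (a + c) τ`, where `τ = t² - t`, has no
Darboux polynomial over the field of rational functions in `t`. -/
theorem natDegree_eq_zero_of_dvd_implicitDeriv {k K : Type*} [Field k] [CharZero k] [Field K]
    [Differential K] [Algebra k[X] K] [IsFractionRing k[X] K]
    (hK : ∀ p : k[X], (algebraMap k[X] K p)′ = algebraMap k[X] K ((X ^ 2 - X) * derivative p))
    {a c d f : k} (hsum : a + 2 * c + d + f = 1)
    (hind : ∀ n₀ n₁ n₂ n₃ : ℤ, (n₀ + n₁ * a + n₂ * d + n₃ * f : k) = 0 → n₀ = 0)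
    {G : K[X]} (hG : G ≠ 0)
    (h : G ∣ Differential.implicitDeriv
      (-X ^ 2 + C (algebraMap k[X] K (C (d + f) * X + C (-f))) * X +
        C (algebraMap k[X] K (C (-(c * (a + c))) * (X ^ 2 - X)))) G) :
    G.natDegree = 0 := by
  classical
  let : NormalizedGCDMonoid k[X] := Classical.choice inferInstance
  let : Differential k[X] :=
    ⟨((X ^ 2 - X : k[X]) • (derivative' : Derivation k k[X] k[X])).restrictScalars ℤ⟩
  have hinj := IsFractionRing.injective k[X] K
  obtain ⟨P, u, hP, hu, rfl⟩ := exists_isPrimitive_associate (R := k[X]) hG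
  have hD : ∀ j, (Differential.mapCoeffs P).coeff j = (X ^ 2 - X) * derivative (P.coeff j) :=
    fun j => by rw [Differential.coeff_mapCoeffs]; rfl
  obtain ⟨v, hv⟩ : ∃ v : k[X][X], v = -X ^ 2 + C (C (d + f) * X + C (-f)) * X +
    C (C (-(c * (a + c))) * (X ^ 2 - X)) := ⟨_, rfl⟩
  have hv' : (-X ^ 2 + C (algebraMap k[X] K (C (d + f) * X + C (-f))) * X +
        C (algebraMap k[X] K (C (-(c * (a + c))) * (X ^ 2 - X)))) =
      v.map (algebraMap k[X] K) := by
    simp [hv]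
  have hm : Differential.implicitDeriv (v.map (algebraMap k[X] K)) (P.map (algebraMap k[X] K)) =
      (Differential.mapCoeffs P + v * derivative P).map (algebraMap k[X] K) := by
    rw [Polynomial.map_add, Polynomial.map_mul, ← derivative_map]
    have : Differential.mapCoeffs (P.map (algebraMap k[X] K)) =
        (Differential.mapCoeffs P).map (algebraMap k[X] K) := by
      ext j
      rw [Differential.coeff_mapCoeffs, coeff_map, coeff_map, hD, hK]
    rw [← this]
    simp [Differential.implicitDeriv]
  -- In the derivative of `u P` the term with `u′` is a multiple of `P` and `u` is a unit; Gauss's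
  -- lemma then moves the divisibility from `K[Y]` to `k[t][Y]`.
  have hdvd : P ∣ Differential.mapCoeffs P + v * derivative P := by
    rw [hP.dvd_iff_fraction_map_dvd_fraction_map K, ← hm]
    rw [hv', Derivation.leibniz, Differential.implicitDeriv_C, smul_eq_mul, smul_eq_mul] at h
    have h2 := (dvd_add_left ((dvd_mul_right (P.map (algebraMap k[X] K)) (C u′)))).1
      ((dvd_mul_left _ _).trans h)
    exact ((isUnit_C.2 hu.isUnit).dvd_mul_left).1 h2
  subst hv
  obtain ⟨g, hg⟩ := exists_cofactor hP.ne_zero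
    (natDegree_le_iff_coeff_eq_zero.2 fun i hi => by
      rw [hD, coeff_eq_zero_of_natDegree_lt hi]; simp) hdvd
  rw [natDegree_C_mul hu, natDegree_map_eq_of_injective hinj]
  exact natDegree_eq_zero_of_darboux hsum hind (map_eval_ne_zero_of_isPrimitive hP 0)
    (map_eval_ne_zero_of_isPrimitive hP 1) hD (g := g) (by rw [hg]; simp)

/-! ### Differential subfields and algebraic solutions -/

/-- The differential structure on an intermediate field closed under derivation. -/
abbrev differentialOfDerivMem {F E : Type*} [Field F] [Field E] [Algebra F E] [Differential E]
    (L : IntermediateField F E) (hL : ∀ x ∈ L, x′ ∈ L) : Differential L where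
  deriv := Derivation.mk'
    ({ toFun := fun x => ⟨(x : E)′, hL x x.2⟩
       map_add' := fun x y => Subtype.ext (by simp)
       map_smul' := fun n x => Subtype.ext (by simp) } : L →ₗ[ℤ] L)
    fun x y => Subtype.ext (by simp)

theorem differentialAlgebra_of_deriv_mem {F E : Type*} [Field F] [Field E] [Algebra F E]
    [Differential E] (L : IntermediateField F E) (hL : ∀ x ∈ L, x′ ∈ L) :
    letI := differentialOfDerivMem L hL
    DifferentialAlgebra L E :=
  letI := differentialOfDerivMem L hL
  ⟨fun _ => rfl⟩

theorem deriv_mem_adjoin {F E : Type*} [Field F] [Field E] [Algebra F E] [Differential E]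
    {S : Set E} (hF : ∀ c : F, (algebraMap F E c)′ ∈ IntermediateField.adjoin F S)
    (hS : ∀ s ∈ S, s′ ∈ IntermediateField.adjoin F S) :
    ∀ x ∈ IntermediateField.adjoin F S, x′ ∈ IntermediateField.adjoin F S := by
  intro x hx
  induction hx using IntermediateField.adjoin_induction with
  | mem x hx => exact hS x hx
  | algebraMap c => exact hF c
  | add x y hx hy ihx ihy => rw [map_add]; exact add_mem ihx ihy
  | inv x hx ih =>
    rw [Derivation.leibniz_inv, smul_eq_mul]
    exact mul_mem (neg_mem (pow_mem (inv_mem hx) 2)) ih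
  | mul x y hx hy ihx ihy =>
    rw [Derivation.leibniz]
    exact add_mem (mul_mem hx ihy) (mul_mem hy ihx)

section

variable {K U : Type*} [Field K] [Field U] [Algebra K U] [Differential K] [Differential U]
  [DifferentialAlgebra K U]

/-- `implicitDeriv v Q` takes at `y` the value `Q(y)′`, so it vanishes there whenever `Q` does. -/
theorem minpoly_dvd_implicitDeriv {y : U} {v : K[X]} (hy : y′ = aeval y v) :
    minpoly K y ∣ Differential.implicitDeriv v (minpoly K y) := by
  apply minpoly.dvd
  rw [← Differential.deriv_aeval_eq_implicitDeriv y v hy, minpoly.aeval, map_zero]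

/-- If a linear differential equation of order one has an algebraic solution, then it has a
solution in the base field. -/
theorem exists_deriv_eq_of_isIntegral [CharZero K] {w : U} {a b : K} (hw : IsIntegral K w)
    (h : w′ = algebraMap K U a * w + algebraMap K U b) : ∃ z : K, z′ = a * z + b := by
  have hdvd := minpoly_dvd_implicitDeriv (y := w) (v := C a * X + C b) (by simpa using h)
  have hpos := minpoly.natDegree_pos hw
  have hmon := minpoly.monic hw
  generalize minpoly K w = Q at hdvd hpos hmon
  have hcoeff : ∀ i, (Differential.implicitDeriv (C a * X + C b) Q).coeff i =
      (Q.coeff i)′ + a * (i * Q.coeff i) + b * (Q.coeff (i + 1) * (i + 1)) := by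
    intro i
    have e : Differential.implicitDeriv (C a * X + C b) Q =
        Differential.mapCoeffs Q + C a * (X * derivative Q) + C b * derivative Q := by
      simp [Differential.implicitDeriv]; ring
    have e3 : (X * derivative Q).coeff i = i * Q.coeff i := by
      cases i with
      | zero => simp
      | succ i => rw [coeff_X_mul, coeff_derivative]; push_cast; ring
    rw [e, coeff_add, coeff_add, coeff_C_mul, coeff_C_mul, Differential.coeff_mapCoeffs, e3,
      coeff_derivative]
  obtain ⟨s, hs⟩ := hdvd
  have hdeg : (Differential.implicitDeriv (C a * X + C b) Q).natDegree ≤ Q.natDegree := by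
    rw [natDegree_le_iff_coeff_eq_zero]
    intro i hi
    rw [hcoeff, coeff_eq_zero_of_natDegree_lt hi, coeff_eq_zero_of_natDegree_lt (hi.trans i.lt_succ_self)]
    simp
  have hs0 : s.natDegree = 0 := by
    by_cases hs0 : s = 0
    · simp [hs0]
    rw [hs, hmon.natDegree_mul' hs0] at hdeg
    lia
  rw [eq_C_of_natDegree_eq_zero hs0] at hs
  generalize s.coeff 0 = r at hs
  have hn := hcoeff Q.natDegree
  obtain ⟨n, hn'⟩ : ∃ n, Q.natDegree = n + 1 := ⟨Q.natDegree - 1, by lia⟩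
  have hn1 := hcoeff n
  have hc1 : Q.coeff (n + 1) = 1 := by rw [← hn']; exact hmon.coeff_natDegree
  rw [hs, coeff_mul_C, coeff_eq_zero_of_natDegree_lt (Nat.lt_succ_self _), hn', hc1] at hn
  rw [hs, coeff_mul_C, hc1] at hn1
  simp only [Derivation.map_one_eq_zero] at hn
  have hne : ((n + 1 : ℕ) : K) ≠ 0 := Nat.cast_ne_zero.2 n.succ_ne_zero
  -- `z` is the average of the conjugates of `w`. The top coefficient gives the cofactor `r = (n +
  -- 1) a`, and the next one is the equation for `z`.
  obtain ⟨z, hz⟩ : ∃ z, Q.coeff n = -(((n + 1 : ℕ) : K) * z) :=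
    ⟨-Q.coeff n / ((n + 1 : ℕ) : K), by field_simp⟩
  refine ⟨z, ?_⟩
  rw [hz, map_neg, Derivation.leibniz, Derivation.map_natCast, smul_zero, add_zero,
    smul_eq_mul] at hn1
  apply mul_left_cancel₀ hne
  push_cast at hn hn1 ⊢
  linear_combination hn1 + (n + 1) * z * hn

/-! ### Riccati equations without Darboux polynomials -/

variable {M N : K}

/-- The minimal polynomial of an algebraic solution would be a Darboux polynomial of positive
degree. -/
theorem transcendental_of_riccati
    (hnd : ∀ G : K[X], G ≠ 0 →
      G ∣ Differential.implicitDeriv (-X ^ 2 + C M * X + C N) G → G.natDegree = 0)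
    {y : U} (hy : y′ = aeval y (-X ^ 2 + C M * X + C N : K[X])) : Transcendental K y := by
  intro h
  have hi := h.isIntegral
  exact (minpoly.natDegree_pos hi).ne' (hnd _ (minpoly.ne_zero hi) (minpoly_dvd_implicitDeriv hy))

/-- The linear equation satisfied by `(y₂ - y)⁻¹`, where `y₂` is a second solution of the Riccati
equation, has no solution in `K(y)`. -/
theorem deriv_ne_of_mem_adjoin [CharZero K]
    (hnd : ∀ G : K[X], G ≠ 0 →
      G ∣ Differential.implicitDeriv (-X ^ 2 + C M * X + C N) G → G.natDegree = 0)
    {y : U} (hy : y′ = aeval y (-X ^ 2 + C M * X + C N : K[X]))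
    {w : U} (hw : w ∈ IntermediateField.adjoin K {y}) :
    w′ ≠ (2 * y - algebraMap K U M) * w + 1 := by
  intro h
  have htr := transcendental_of_riccati hnd hy
  have hinj : ∀ p q : K[X], aeval y p = aeval y q → p = q :=
    fun p q hpq => transcendental_iff_injective.1 htr hpq
  set v : K[X] := -X ^ 2 + C M * X + C N with hv
  have hD := Differential.deriv_aeval_eq_implicitDeriv y v hy
  -- Write `w = F / G` in lowest terms. The equation makes `G` divide its own derivative, so `G` is
  -- constant and `w` is a polynomial in `y`.
  have key : ∃ F : K[X], Differential.implicitDeriv v F = (2 * X - C M) * F + 1 := by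
    obtain ⟨r, s, rfl⟩ := (IntermediateField.mem_adjoin_simple_iff K w).1 hw
    by_cases hs : aeval y s = 0
    · simp [hs] at h
    let : GCDMonoid K[X] := UniqueFactorizationMonoid.toGCDMonoid _
    obtain ⟨F, G, hr, hs', hu⟩ := extract_gcd r s
    have hcop : IsCoprime G F := ((gcd_isUnit_iff F G).1 hu).symm
    generalize GCDMonoid.gcd r s = D at hr hs'
    have hD0 : aeval y D ≠ 0 := by
      intro h0
      exact hs (by rw [hs', map_mul, h0, zero_mul])
    have hG0 : aeval y G ≠ 0 := fun h0 => hs (by rw [hs', map_mul, h0, mul_zero])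
    rw [hr, hs', map_mul, map_mul, mul_div_mul_left _ _ hD0] at h
    obtain ⟨w, hw⟩ : ∃ w, w = aeval y F / aeval y G := ⟨_, rfl⟩
    rw [← hw] at h
    rw [eq_div_iff hG0] at hw
    have hFG := congrArg (·′) hw
    simp only [Derivation.leibniz, hD, h, smul_eq_mul] at hFG
    have hpoly : (2 * X - C M) * F * G + G ^ 2 + F * Differential.implicitDeriv v G =
        Differential.implicitDeriv v F * G := by
      apply hinj
      simp only [map_add, map_mul, map_sub, map_pow, aeval_X, aeval_C, map_ofNat]
      rw [← hFG, ← hw]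
      ring
    have hGd : G ∣ Differential.implicitDeriv v G := by
      refine hcop.dvd_of_dvd_mul_left
        ⟨Differential.implicitDeriv v F - (2 * X - C M) * F - G, ?_⟩
      linear_combination hpoly
    have hG : G ≠ 0 := by
      rintro rfl
      simp at hG0
    obtain ⟨c, rfl⟩ : ∃ c, G = C c := ⟨_, eq_C_of_natDegree_eq_zero (hnd G hG hGd)⟩
    have hc : c ≠ 0 := by simpa using hG
    refine ⟨C c⁻¹ * F, ?_⟩
    have hcc : C c * C c⁻¹ = (1 : K[X]) := by rw [← C_mul, mul_inv_cancel₀ hc, C_1]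
    rw [Derivation.leibniz, Differential.implicitDeriv_C, Derivation.leibniz_inv]
    rw [Differential.implicitDeriv_C] at hpoly
    simp only [smul_eq_mul, C_mul, C_neg, C_pow]
    apply mul_left_cancel₀ (mul_ne_zero hG hG)
    have hcc2 : C c * C c * C c⁻¹ ^ 2 = (1 : K[X]) := by linear_combination (C c * C c⁻¹ + 1) * hcc
    linear_combination -hpoly - F * C c′ * hcc2 +
      (Differential.implicitDeriv v F * C c - (2 * X - C M) * F * C c) * hcc
  obtain ⟨F, hF⟩ := key
  -- In degree `F.natDegree + 1` the left side has `-F.natDegree` times the leading coefficient, the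
  -- right side has twice it. So `F = 0`, and the equation reads `0 = 1`.
  have hcoeff : F.coeff F.natDegree = 0 := by
    have hv2 : v.natDegree ≤ 2 := by rw [hv]; compute_degree
    have hv' : v.coeff 2 = -1 := by simp [hv]
    have h2 : (2 * X - C M).natDegree ≤ 1 := by compute_degree
    have hc := congrArg (coeff · (F.natDegree + 1)) hF
    have e : Differential.implicitDeriv v F = Differential.mapCoeffs F + v * derivative F := by
      simp [Differential.implicitDeriv]
    simp only [e, coeff_add] at hc
    rw [Differential.coeff_mapCoeffs, coeff_eq_zero_of_natDegree_lt (Nat.lt_succ_self F.natDegree),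
      add_comm F.natDegree 1, coeff_mul_add_eq_of_natDegree_le h2 le_rfl, coeff_one,
      if_neg (by lia)] at hc
    have hd : (v * derivative F).coeff (1 + F.natDegree) = -(F.natDegree * F.coeff F.natDegree) := by
      rcases Nat.eq_zero_or_pos F.natDegree with h0 | hpos
      · rw [eq_C_of_natDegree_eq_zero h0]; simp
      · rw [show 1 + F.natDegree = 2 + (F.natDegree - 1) by lia,
          coeff_mul_add_eq_of_natDegree_le hv2 (natDegree_derivative_le F), coeff_derivative,
          Nat.sub_add_cancel hpos, hv', Nat.cast_sub hpos]
        push_cast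
        ring
    rw [hd] at hc
    have h2c : (2 * X - C M).coeff 1 = 2 := by simp
    rw [h2c] at hc
    have hne : ((F.natDegree + 2 : ℕ) : K) ≠ 0 := Nat.cast_ne_zero.2 (by lia)
    apply mul_left_cancel₀ hne
    push_cast
    simp only [map_zero] at hc
    linear_combination -hc
  rw [coeff_natDegree, leadingCoeff_eq_zero] at hcoeff
  simp [hcoeff] at hF

/-- Two distinct solutions of a Riccati equation without Darboux polynomials are algebraically
independent. -/
theorem algebraicIndepOn_of_riccati [CharZero K]
    (hnd : ∀ G : K[X], G ≠ 0 →
      G ∣ Differential.implicitDeriv (-X ^ 2 + C M * X + C N) G → G.natDegree = 0)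
    {y₁ y₂ : U} (h₁ : y₁′ = aeval y₁ (-X ^ 2 + C M * X + C N : K[X]))
    (h₂ : y₂′ = aeval y₂ (-X ^ 2 + C M * X + C N : K[X])) (hne : y₁ ≠ y₂) :
    AlgebraicIndepOn K id {y₂, y₁} := by
  have htr := transcendental_of_riccati hnd h₁
  refine AlgebraicIndepOn.insert ?_ ?_
  · exact (algebraicIndependent_unique_type_iff (ι := ({y₁} : Set U))).2 htr
  rw [Set.image_id, id, ← IntermediateField.transcendental_adjoin_iff]
  intro halg
  let L := IntermediateField.adjoin K {y₁}
  have hyL : y₁ ∈ L := IntermediateField.mem_adjoin_simple_self K y₁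
  have hL : ∀ x ∈ L, x′ ∈ L := by
    apply deriv_mem_adjoin
    · intro c
      rw [deriv_algebraMap]
      exact L.algebraMap_mem _
    · intro y hy
      rw [Set.mem_singleton_iff.1 hy, h₁]
      exact IntermediateField.algebra_adjoin_le_adjoin K _ (aeval_mem_adjoin_singleton K y₁)
  let := differentialOfDerivMem L hL
  have := differentialAlgebra_of_deriv_mem L hL
  have hd : y₂ - y₁ ≠ 0 := sub_ne_zero.2 hne.symm
  have halg' : IsIntegral L (y₂ - y₁)⁻¹ :=
    ((halg.isIntegral.sub (isIntegral_algebraMap (x := (⟨y₁, hyL⟩ : L))))).inv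
  simp only [map_add, map_neg, map_mul, map_pow, aeval_X, aeval_C] at h₁ h₂
  -- The difference `u = y₂ - y₁` satisfies the Bernoulli equation `u′ = (M - 2 y₁) u - u²`, which
  -- is linear in `u⁻¹`.
  obtain ⟨z, hz⟩ := exists_deriv_eq_of_isIntegral (K := L)
    (a := 2 * ⟨y₁, hyL⟩ - algebraMap K L M) (b := 1) halg' (by
      rw [Derivation.leibniz_inv, map_sub, h₁, h₂]
      simp only [map_sub, map_mul, map_ofNat, map_one, smul_eq_mul]
      rw [← IsScalarTower.algebraMap_apply K L U, IntermediateField.algebraMap_apply]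
      field_simp
      ring)
  refine deriv_ne_of_mem_adjoin hnd (y := y₁) (w := z) (by simpa using h₁) z.2 ?_
  exact congrArg (algebraMap L U) hz

end

/-! ### Transcendence degree and the field `k(t)` -/

open scoped IntermediateField.algebraAdjoinAdjoin in
/-- The transcendence degree of a purely transcendental extension. -/
theorem trdeg_adjoin_of_algebraicIndepOn {K U : Type*} [Field K] [Field U] [Algebra K U] {S : Set U}
    (hS : AlgebraicIndepOn K id S) :
    Algebra.trdeg K (IntermediateField.adjoin K S) = Cardinal.mk S := by
  have h := trdeg_add_eq K (Algebra.adjoin K S) (A := IntermediateField.adjoin K S)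
  rw [trdeg_eq_zero (R := Algebra.adjoin K S), add_zero] at h
  rw [← h]
  have e := hS.aevalEquiv
  rw [Set.image_id] at e
  have := e.lift_trdeg_eq
  simpa using this.symm

/-- An algebraic element would lie in the algebraically closed field `k`, hence be constant. -/
theorem transcendental_of_deriv_eq_one {k U : Type*} [Field k] [IsAlgClosed k] [Field U]
    [Algebra k U] [Differential U] (hconst : ∀ c : k, (algebraMap k U c)′ = 0) {t : U}
    (ht : t′ = 1) : Transcendental k t := by
  intro h
  obtain ⟨c, rfl⟩ : t ∈ (algebraMap k U).range := h.isIntegral.mem_range_algebraMap_of_minpoly_splits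
    (IsAlgClosed.splits _)
  rw [hconst] at ht
  exact zero_ne_one ht

theorem isFractionRing_polynomial_adjoin {k U : Type*} [Field k] [Field U] [Algebra k U] {t : U}
    (ht : Transcendental k t) :
    letI : Algebra k[X] (IntermediateField.adjoin k {t}) :=
      (aeval (IntermediateField.AdjoinSimple.gen k t)).toRingHom.toAlgebra
    IsFractionRing k[X] (IntermediateField.adjoin k {t}) := by
  let : Algebra k[X] (IntermediateField.adjoin k {t}) :=
    (aeval (IntermediateField.AdjoinSimple.gen k t)).toRingHom.toAlgebra
  have hcoe : ∀ p : k[X], ((algebraMap k[X] (IntermediateField.adjoin k {t}) p : _) : U) =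
      aeval t p := fun p => by
    rw [RingHom.algebraMap_toAlgebra]
    simp
  have : FaithfulSMul k[X] (IntermediateField.adjoin k {t}) := by
    rw [faithfulSMul_iff_algebraMap_injective]
    intro p q hpq
    apply transcendental_iff_injective.1 ht
    rw [← hcoe, ← hcoe, hpq]
  refine .of_field _ _ fun z => ?_
  obtain ⟨r, s, hz⟩ := (IntermediateField.mem_adjoin_simple_iff k (z : U)).1 z.2
  exact ⟨r, s, Subtype.ext (by rw [hz]; simp [hcoe])⟩

theorem deriv_aeval_of_const {k U : Type*} [Field k] [Field U] [Algebra k U] [Differential U]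
    (hconst : ∀ c : k, (algebraMap k U c)′ = 0) (t : U) (p : k[X]) :
    (aeval t p)′ = aeval t (derivative p) * t′ := by
  induction p using Polynomial.induction_on' with
  | add p q hp hq => simp only [map_add, hp, hq, add_mul]
  | monomial n c =>
    simp [aeval_monomial, derivative_monomial, hconst, Derivation.leibniz_pow]
    ring

/-- Algebraic independence of two solutions of the Riccati equation in the normalised form. -/
theorem algebraicIndepOn_of_normalised_riccati {k U : Type*} [Field k] [CharZero k] [Field U]
    [Algebra k U] [Differential U] (hconst : ∀ c : k, (algebraMap k U c)′ = 0) {t : U}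
    (ht : t′ = t ^ 2 - t) (htr : Transcendental k t) {a c d f : k} (hsum : a + 2 * c + d + f = 1)
    (hind : ∀ n₀ n₁ n₂ n₃ : ℤ, (n₀ + n₁ * a + n₂ * d + n₃ * f : k) = 0 → n₀ = 0) {y₁ y₂ : U}
    (hy : ∀ y ∈ ({y₁, y₂} : Set U), y′ = -y ^ 2 + (algebraMap k U (d + f) * t - algebraMap k U f) * y
      - algebraMap k U (c * (a + c)) * (t ^ 2 - t)) (hne : y₁ ≠ y₂) :
    AlgebraicIndepOn (IntermediateField.adjoin k {t}) id {y₂, y₁} := by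
  set K := IntermediateField.adjoin k {t}
  have htK : t ∈ K := IntermediateField.mem_adjoin_simple_self k t
  have hKd : ∀ x ∈ K, x′ ∈ K := by
    apply deriv_mem_adjoin
    · intro c
      rw [hconst]
      exact zero_mem _
    · intro s hs
      rw [Set.mem_singleton_iff.1 hs, ht]
      exact sub_mem (pow_mem htK 2) htK
  let := differentialOfDerivMem K hKd
  have := differentialAlgebra_of_deriv_mem K hKd
  let : Algebra k[X] K := (aeval (IntermediateField.AdjoinSimple.gen k t)).toRingHom.toAlgebra
  have : IsFractionRing k[X] K := isFractionRing_polynomial_adjoin htr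
  have hcoe : ∀ p : k[X], algebraMap K U (algebraMap k[X] K p) = aeval t p := fun p => by
    rw [RingHom.algebraMap_toAlgebra]
    simp [K]
  have hchar : CharZero K := charZero_of_injective_algebraMap (algebraMap k K).injective
  have hK : ∀ p : k[X], (algebraMap k[X] K p)′ = algebraMap k[X] K ((X ^ 2 - X) * derivative p) := by
    intro p
    apply (algebraMap K U).injective
    rw [← deriv_algebraMap, hcoe, hcoe, deriv_aeval_of_const hconst, ht]
    simp [mul_comm]
  have hv : ∀ y : U, -y ^ 2 + (algebraMap k U (d + f) * t - algebraMap k U f) * y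
      - algebraMap k U (c * (a + c)) * (t ^ 2 - t) =
      aeval y (-X ^ 2 + C (algebraMap k[X] K (C (d + f) * X + C (-f))) * X +
        C (algebraMap k[X] K (C (-(c * (a + c))) * (X ^ 2 - X))) : K[X]) := by
    intro y
    simp only [map_add, map_neg, map_mul, map_pow, aeval_X, aeval_C, map_sub, hcoe]
    ring
  refine algebraicIndepOn_of_riccati
    (fun G hG h => natDegree_eq_zero_of_dvd_implicitDeriv hK hsum hind hG h) ?_ ?_ hne
  · rw [← hv]
    exact hy y₁ (by simp)
  · rw [← hv]
    exact hy y₂ (by simp)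

/-- Evaluating the linear relation, as a polynomial identity, at the origin isolates `n₀`. -/
theorem int_eq_zero_of_algebraicIndependent {A : Type*} [Field A] [CharZero A] {a d f : A}
    (h : AlgebraicIndependent ℚ ![a, d, f]) (n₀ n₁ n₂ n₃ : ℤ)
    (h0 : (n₀ + n₁ * a + n₂ * d + n₃ * f : A) = 0) : n₀ = 0 := by
  have := algebraicIndependent_iff.1 h
    (MvPolynomial.C (n₀ : ℚ) + MvPolynomial.C (n₁ : ℚ) * MvPolynomial.X 0 +
      MvPolynomial.C (n₂ : ℚ) * MvPolynomial.X 1 + MvPolynomial.C (n₃ : ℚ) * MvPolynomial.X 2)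
    (by simpa using h0)
  simpa using congrArg (MvPolynomial.eval ![(0 : ℚ), 0, 0]) this

/-! ### Bäcklund transformations preserve the generated field -/

/-- The maps are rational over `ℂ(t)`; a zero denominator is harmless, since the quotient is then
`0`. -/
theorem backlundMap_mem {U : Type*} [Field U] [Algebra ℂ U] {t : U} (L : IntermediateField ℂ U)
    (ht : t ∈ L) (i : Fin 5) (s : (Fin 5 → ℂ) × (U × U)) (h : s.2.1 ∈ L ∧ s.2.2 ∈ L) :
    (backlundMap t i s).2.1 ∈ L ∧ (backlundMap t i s).2.2 ∈ L := by
  obtain ⟨α, y, x⟩ := s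
  obtain ⟨hy, hx⟩ := h
  have hc : ∀ c, algebraMap ℂ U c ∈ L := L.algebraMap_mem
  fin_cases i
  · exact ⟨hy, sub_mem hx (div_mem (hc _) (sub_mem hy ht))⟩
  · exact ⟨hy, hx⟩
  · exact ⟨add_mem hy (div_mem (hc _) hx), hx⟩
  · exact ⟨hy, sub_mem hx (div_mem (hc _) (sub_mem hy L.one_mem))⟩
  · exact ⟨hy, sub_mem hx (div_mem (hc _) hy)⟩

/-- The powers of `shift` do not change the field generated by a point over `ℂ(t)`. -/
theorem shift_zpow_mem_iff {U : Type*} [Field U] [Algebra ℂ U] {t : U} (L : IntermediateField ℂ U)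
    (ht : t ∈ L) (n : ℤ) (s : (Fin 5 → ℂ) × (U × U)) :
    (((shift t ^ n) s).2.1 ∈ L ∧ ((shift t ^ n) s).2.2 ∈ L) ↔ (s.2.1 ∈ L ∧ s.2.2 ∈ L) := by
  have hb : ∀ i, backlund t i ∈ Subgroup.closure (Set.range (backlund t)) :=
    fun i => Subgroup.subset_closure ⟨i, rfl⟩
  have hmem : shift t ^ n ∈ Subgroup.closure (Set.range (backlund t)) := by
    refine zpow_mem ?_ n
    simp only [shift]
    repeat' apply mul_mem
    all_goals exact hb _
  generalize shift t ^ n = σ at hmem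
  induction hmem using Subgroup.closure_induction generalizing s with
  | mem σ h =>
    obtain ⟨i, rfl⟩ := h
    -- The converse follows by applying the same involution again.
    refine ⟨fun h => ?_, backlundMap_mem L ht i s⟩
    simpa [backlund, backlundMap_involutive t i s] using backlundMap_mem L ht i (backlund t i s) h
  | one => rfl
  | mul σ ρ _ _ h₁ h₂ => exact (h₁ _).trans (h₂ _)
  | inv σ _ h =>
    have := h (σ⁻¹ s)
    rw [show σ (σ⁻¹ s) = s from σ.apply_symm_apply s] at this
    exact this.symm

/-- The point of `R(α)` with `α₀ = 2n` belonging to a solution of the normalised Riccati equation. -/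
noncomputable def riccatiPoint {U : Type*} [Field U] [Algebra ℂ U] (t : U) (α : Fin 5 → ℂ) (n : ℤ)
    (y : U) : U × U :=
  ((shift t ^ n) (![0, α 1, α 2 + n, α 3, α 4], (t, y / (t ^ 2 - t)))).2

/-- As `L` varies, this says that the point and `y` generate the same field over `ℂ(t)`. -/
theorem riccatiPoint_mem_iff {U : Type*} [Field U] [Algebra ℂ U] {t : U} (ht : t ^ 2 - t ≠ 0)
    (α : Fin 5 → ℂ) (n : ℤ) (y : U)
    (L : IntermediateField (IntermediateField.adjoin ℂ {t}) U) :
    ((riccatiPoint t α n y).1 ∈ L ∧ (riccatiPoint t α n y).2 ∈ L) ↔ y ∈ L := by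
  have htL : t ∈ L.restrictScalars ℂ :=
    L.algebraMap_mem (IntermediateField.AdjoinSimple.gen ℂ t)
  have h := shift_zpow_mem_iff (L.restrictScalars ℂ) htL n
    (![0, α 1, α 2 + n, α 3, α 4], (t, y / (t ^ 2 - t)))
  have hτ : t ^ 2 - t ∈ L := sub_mem (pow_mem htL 2) htL
  refine Iff.trans h ⟨fun h => ?_, fun h => ⟨htL, div_mem h hτ⟩⟩
  rw [← div_mul_cancel₀ y ht]
  exact mul_mem h.2 hτ

/-- Take `y = τ x` with `τ = t² - t`: the term `τ′ x = (2 t - 1) x` cancels the shift `-2 t + 1` in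
the linear coefficient. -/
theorem exists_eq_riccatiPoint {U : Type*} [Field U] [Algebra ℂ U] [Differential U]
    {t : U} (ht : t′ = 1) (hτ : t ^ 2 - t ≠ 0)
    {α : Fin 5 → ℂ} {n : ℤ} (hn : α 0 = 2 * (n : ℂ)) {p : U × U} (hp : p ∈ riccatiSubvariety t α) :
    ∃ y, p = riccatiPoint t α n y ∧
      (t ^ 2 - t) * y′ = -y ^ 2 + (algebraMap ℂ U (α 3 + α 4) * t - algebraMap ℂ U (α 4)) * y
      - algebraMap ℂ U ((α 2 + n) * (α 1 + (α 2 + n))) * (t ^ 2 - t) := by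
  obtain ⟨m, hm, ⟨z, x⟩, ⟨hz, hx⟩, h⟩ := hp
  obtain rfl : n = m := by
    rw [hn] at hm
    exact_mod_cast mul_left_cancel₀ two_ne_zero hm
  simp only at hz hx
  subst hz
  refine ⟨(z ^ 2 - z) * x, ?_, ?_⟩
  · rw [riccatiPoint, mul_div_cancel_left₀ _ hτ, h]
  · have e : z * (z - 1) = z ^ 2 - z := by ring
    rw [e] at hx
    have hx' : (z ^ 2 - z) * x′ = -(z ^ 2 - z) * x ^ 2 +
        ((algebraMap ℂ U (α 3) + algebraMap ℂ U (α 4) - 2) * z - algebraMap ℂ U (α 4) + 1) * x -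
        algebraMap ℂ U (α 2 + n) * (algebraMap ℂ U (α 1) + algebraMap ℂ U (α 2 + n)) := by
      generalize z ^ 2 - z = τ at *
      rw [hx]
      field_simp
    simp only [Derivation.leibniz, Derivation.leibniz_pow, map_sub, ht, smul_eq_mul, map_add,
      map_mul, nsmul_eq_mul] at hx' ⊢
    push_cast
    linear_combination (z ^ 2 - z) * hx'

end PainleveVI

/-! ### Algebraic independence of the two points -/

theorem proposition3p4 {U : Type*} [Field U] [Algebra ℂ U] [Differential U]
    (hconst : ∀ u : U, u′ = 0 ↔ u ∈ Set.range (algebraMap ℂ U))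
    (t : U) (ht : t′ = 1)
    (α : Fin 5 → ℂ) (hsum : α 0 + α 1 + 2 * α 2 + α 3 + α 4 = 1)
    (hα : AlgebraicIndependent ℚ ![α 1, α 3, α 4])
    (hα₀ : ∃ n : ℤ, α 0 = 2 * (n : ℂ))
    (p q : U × U) (hp : p ∈ PainleveVI.riccatiSubvariety t α)
    (hq : q ∈ PainleveVI.riccatiSubvariety t α) (hpq : p ≠ q) :
    let K := IntermediateField.adjoin ℂ {t}
    Algebra.trdeg K (IntermediateField.adjoin K {p.1, p.2}) = 1 ∧
    Algebra.trdeg K (IntermediateField.adjoin K {q.1, q.2}) = 1 ∧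
    Algebra.trdeg K (IntermediateField.adjoin K {p.1, p.2, q.1, q.2}) = 2 := by
  intro K
  obtain ⟨n, hn⟩ := hα₀
  have hc : ∀ c : ℂ, (algebraMap ℂ U c)′ = 0 := fun c => (hconst _).2 ⟨c, rfl⟩
  have htr : Transcendental ℂ t := PainleveVI.transcendental_of_deriv_eq_one hc ht
  have hτ : t ^ 2 - t ≠ 0 := by
    intro h
    rcases mul_eq_zero.1 (show t * (t - 1) = 0 by linear_combination h) with h | h
    · simp [h] at ht
    · simp [sub_eq_zero.1 h] at ht
  obtain ⟨y₁, rfl, h₁⟩ := PainleveVI.exists_eq_riccatiPoint ht hτ hn hp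
  obtain ⟨y₂, rfl, h₂⟩ := PainleveVI.exists_eq_riccatiPoint ht hτ hn hq
  have hne : y₁ ≠ y₂ := fun h => hpq (by rw [h])
  have hind : AlgebraicIndepOn K id {y₂, y₁} :=
    -- `U` is given the rescaled derivation `(t² - t) d/dt` here, in which the Riccati equation has
    -- polynomial coefficients.
    @PainleveVI.algebraicIndepOn_of_normalised_riccati ℂ U _ _ _ _
      ⟨(t ^ 2 - t) • Differential.deriv⟩ (fun c => by simp [Differential.deriv, hc])
      t (by simp [Differential.deriv, ht]) htr (α 1) (α 2 + n) (α 3) (α 4)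
      (by linear_combination hsum - hn) (PainleveVI.int_eq_zero_of_algebraicIndependent hα) y₁ y₂
      (by
        rintro y (rfl | rfl)
        · exact h₁
        · exact h₂) hne
  have hle : ∀ y (L : IntermediateField K U), _ := PainleveVI.riccatiPoint_mem_iff hτ α n
  have hK₁ : ∀ y, IntermediateField.adjoin K
      {(PainleveVI.riccatiPoint t α n y).1, (PainleveVI.riccatiPoint t α n y).2} =
      IntermediateField.adjoin K {y} := by
    intro y
    -- Two intermediate fields agree once they are contained in the same intermediate fields.
    refine eq_of_forall_ge_iff fun L => ?_
    rw [IntermediateField.adjoin_le_iff, IntermediateField.adjoin_le_iff, Set.insert_subset_iff,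
      Set.singleton_subset_iff, Set.singleton_subset_iff]
    exact hle y L
  have hK₂ : IntermediateField.adjoin K
      {(PainleveVI.riccatiPoint t α n y₁).1, (PainleveVI.riccatiPoint t α n y₁).2,
        (PainleveVI.riccatiPoint t α n y₂).1, (PainleveVI.riccatiPoint t α n y₂).2} =
      IntermediateField.adjoin K {y₂, y₁} := by
    refine eq_of_forall_ge_iff fun L => ?_
    simp only [IntermediateField.adjoin_le_iff, Set.insert_subset_iff, Set.singleton_subset_iff,
      SetLike.mem_coe]
    rw [← hle y₁ L, ← hle y₂ L]
    tauto
  rw [hK₁, hK₁, hK₂, PainleveVI.trdeg_adjoin_of_algebraicIndepOn (hind.mono (by simp)),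
    PainleveVI.trdeg_adjoin_of_algebraicIndepOn (hind.mono (by simp)),
    PainleveVI.trdeg_adjoin_of_algebraicIndepOn hind]
  refine ⟨Cardinal.mk_singleton _, Cardinal.mk_singleton _, ?_⟩
  rw [Cardinal.mk_insert (by simpa using hne.symm), Cardinal.mk_singleton, one_add_one_eq_two]
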